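/- \textbf{Conventions.} A directed graph $E=(E^0,E^1,r,s)$ consists of countable sets $E^0$ (vertices) and $E^1$ (edges) and maps $r,s\colon E^1\to E^0$; it is \emph{row-finite} if $r^{-1}(v)$ is finite for all $v\in E^0$, and $v$ is a \emph{source} if $r^{-1}(v)=\varnothing$. For row-finite $E$, a \emph{Cuntz--Krieger $E$-family} in a C*-algebra consists of mutually orthogonal projections $P_v$ ($v\in E^0$) and partial isometries $S_e$ ($e\in E^1$) with mutually orthogonal ranges such that $S_e^*S_e=P_{s(e)}$ for all $e\in E^1$ and $P_v=\sum_{e\in r^{-1}(v)}S_eS_e^*$ for every $v$ that is not a source. The graph C*-algebra $C^*(E)$ is the universal C*-algebra generated by a Cuntz--Krieger $E$-family $\{s_e,p_v\}$. Its \emph{diagonal} $\mathcal D(E)$ is the C*-subalgebra generated by the projections $s_\mu s_\mu^*$, where $\mu$ runs over the finite paths of $E$, that is, over the vertices (with $s_v=p_v$) and the sequences $\mu=e_1\cdots e_n$ of edges with $s(e_i)=r(e_{i+1})$ (with $s_\mu=s_{e_1}\cdots s_{e_n}$). For an edge function $f\colon E^1\to\mathbb Z$, the \emph{weighted gauge action}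 $\gamma^{E,f}$ of $\mathbb T$ on $C^*(E)$ is given by $\gamma^{E,f}_z(s_e)=z^{f(e)}s_e$ and $\gamma^{E,f}_z(p_v)=p_v$. \textbf{In-splits.} Let $E_1=(E_1^0,E_1^1,r_1,s_1)$ be a directed graph. For each $v\in E_1^0$ that is not a source, partition $r_1^{-1}(v)$ into non-empty sets $\mathcal E^v_1,\dots,\mathcal E^v_{m(v)}$; if $v$ is a source, put $m(v)=0$. The corresponding \emph{in-split graph} $E_2$ has \[E_2^0=\{\overline v_i : v\in E_1^0,\ 1\le i\le m(v)\}\cup\{\overline v : v\in E_1^0,\ m(v)=0\},\] \[E_2^1=\{\overline e_j : e\in E_1^1,\ 1\le j\le m(s_1(e))\}\cup\{\overline e : e\in E_1^1,\ m(s_1(e))=0\},\] with $s_2(\overline e)=\overline{s_1(e)}$, $s_2(\overline e_j)=\overline{s_1(e)}_j$ and $r_2(\overline e)=r_2(\overline e_j)=\overline{r_1(e)}_i$, where $e\in\mathcal E^{r_1(e)}_i$. The in-split is \emph{proper} if for every $v$ with $r_1^{-1}(v)$ infinite, $m(v)$ is finite and only one of the sets $\mathcal E^v_i$ is infinite (which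 is automatic if $E_1$ is row-finite). \textbf{Theorem.} Let $E_1$ be a row-finite directed graph and let $E_2$ be a proper in-split graph of $E_1$. Then there exists a *-isomorphism $\pi\colon C^*(E_1)\to C^*(E_2)$ with $\pi(\mathcal D(E_1))=\mathcal D(E_2)$ such that for every edge function $f\colon E_1^1\to\mathbb Z$ there exists an edge function $g\colon E_2^1\to\mathbb Z$ with $\pi\circ\gamma_z^{E_1,f}=\gamma_z^{E_2,g}\circ\pi$ for all $z\in\mathbb T$. -/

import Mathlib

universe u v w w'

noncomputable section

open scoped ENNReal

namespace GraphCStar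

/-! ## Directed graphs -/

/-- A directed graph `E = (E⁰, E¹, r, s)` with countable sets of vertices and edges. -/
structure DirectedGraph where
  Vertex : Type u
  Edge : Type v
  countable_vertex : Countable Vertex
  countable_edge : Countable Edge
  r : Edge → Vertex
  s : Edge → Vertex

attribute [instance] DirectedGraph.countable_vertex DirectedGraph.countable_edge

/-- `E` is row-finite if every vertex receives only finitely many edges. -/
class DirectedGraph.RowFinite (E : DirectedGraph.{u, v}) : Prop where
  finite_preimage : ∀ x : E.Vertex, (E.r ⁻¹' {x}).Finite

/-- The finite set `r⁻¹(x)` of edges with range `x`. -/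
def DirectedGraph.into (E : DirectedGraph.{u, v}) [E.RowFinite] (x : E.Vertex) : Finset E.Edge :=
  (DirectedGraph.RowFinite.finite_preimage x).toFinset

@[simp]
theorem DirectedGraph.mem_into (E : DirectedGraph.{u, v}) [E.RowFinite] (x : E.Vertex)
    (e : E.Edge) : e ∈ E.into x ↔ E.r e = x := by
  simp [DirectedGraph.into]

/-- `x` is a source if it receives no edge. -/
def DirectedGraph.IsSource (E : DirectedGraph.{u, v}) (x : E.Vertex) : Prop :=
  E.r ⁻¹' {x} = ∅

/-- Finite paths, indexed by their range. A path is a vertex, or it is `e μ` for an edge `e` and a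
path `μ` whose range is the source of `e`; so `e₁ ⋯ eₙ` with `s(eᵢ) = r(eᵢ₊₁)` is
`cons e₁ (⋯ (cons eₙ (vertex (s eₙ))))`. -/
inductive FinitePath (E : DirectedGraph.{u, v}) : E.Vertex → Type (max u v)
  | vertex (x : E.Vertex) : FinitePath E x
  | cons (e : E.Edge) (μ : FinitePath E (E.s e)) : FinitePath E (E.r e)

/-! ## Cuntz–Krieger families -/

/-- A Cuntz–Krieger `E`-family in a C⋆-algebra `B`: mutually orthogonal projections `P x` for the
vertices and partial isometries `S e` with mutually orthogonal ranges for the edges, subject to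
(CK1) and (CK2). -/
structure CKFamily (E : DirectedGraph.{u, v}) [E.RowFinite] (B : Type w)
    [NonUnitalCStarAlgebra B] where
  S : E.Edge → B
  P : E.Vertex → B
  partialIsometry : ∀ e, S e * star (S e) * S e = S e
  orthogonal_ranges : ∀ e f, e ≠ f → (S e * star (S e)) * (S f * star (S f)) = 0
  projection : ∀ x, IsStarProjection (P x)
  orthogonal : ∀ x y, x ≠ y → P x * P y = 0
  ck1 : ∀ e, star (S e) * S e = P (E.s e)
  ck2 : ∀ x, ¬ E.IsSource x → P x = ∑ e ∈ E.into x, S e * star (S e)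

namespace CKFamily

variable {E : DirectedGraph.{u, v}} [E.RowFinite] {B : Type w} [NonUnitalCStarAlgebra B]
  {C : Type w'} [NonUnitalCStarAlgebra C]

/-- The generators of a family. -/
def gens (F : CKFamily E B) : Set B := Set.range F.S ∪ Set.range F.P

theorem S_mem_gens (F : CKFamily E B) (e : E.Edge) : F.S e ∈ F.gens := Or.inl ⟨e, rfl⟩

theorem P_mem_gens (F : CKFamily E B) (x : E.Vertex) : F.P x ∈ F.gens := Or.inr ⟨x, rfl⟩

theorem countable_gens (F : CKFamily E B) : F.gens.Countable :=
  (Set.countable_range _).union (Set.countable_range _)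

/-- Restrict a family to a C⋆-algebra that embeds in `B` and contains the generators. -/
def comap (F : CKFamily E C) (φ : B →⋆ₙₐ[ℂ] C) (hφ : Function.Injective φ) (S : E.Edge → B)
    (P : E.Vertex → B) (hS : ∀ e, φ (S e) = F.S e) (hP : ∀ x, φ (P x) = F.P x) :
    CKFamily E B where
  S := S
  P := P
  partialIsometry e := hφ (by simp only [map_mul, map_star, hS, F.partialIsometry])
  orthogonal_ranges e f h := hφ (by
    simp only [map_mul, map_star, map_zero, hS, F.orthogonal_ranges e f h])
  projection x := ⟨hφ (by simpa only [map_mul, hP] using (F.projection x).isIdempotentElem.eq),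
    hφ (by simpa only [map_star, hP] using (F.projection x).isSelfAdjoint.star_eq)⟩
  orthogonal x y h := hφ (by simp only [map_mul, map_zero, hP, F.orthogonal x y h])
  ck1 e := hφ (by simp only [map_mul, map_star, hS, hP, F.ck1])
  ck2 x h := hφ (by simp only [map_sum, map_mul, map_star, hS, hP, F.ck2 x h])

theorem norm_P_le (F : CKFamily E B) (x : E.Vertex) : ‖F.P x‖ ≤ 1 := by
  have h : ‖F.P x‖ * ‖F.P x‖ = ‖F.P x‖ := by
    rw [← CStarRing.norm_star_mul_self, (F.projection x).isSelfAdjoint.star_eq,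
      (F.projection x).isIdempotentElem.eq]
  nlinarith [norm_nonneg (F.P x)]

theorem norm_S_le (F : CKFamily E B) (e : E.Edge) : ‖F.S e‖ ≤ 1 := by
  have h : ‖F.S e‖ * ‖F.S e‖ ≤ 1 := by
    rw [← CStarRing.norm_star_mul_self, F.ck1]
    exact F.norm_P_le _
  nlinarith [norm_nonneg (F.S e)]

/-- The element `S_μ` attached to a finite path: `S_x = P x` and `S_{eμ} = S e * S_μ`
(note that `S e * P (s e) = S e`). -/
def path (F : CKFamily E B) : {x : E.Vertex} → FinitePath E x → B
  | _, .vertex x => F.P x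
  | _, .cons e μ => F.S e * F.path μ

/-- Multiply each `S e` by the scalar `z ^ f e` of modulus one. -/
def twist (F : CKFamily E B) (f : E.Edge → ℤ) (z : Circle) : CKFamily E B where
  S e := ((z ^ f e : Circle) : ℂ) • F.S e
  P := F.P
  partialIsometry e := by
    have h := F.partialIsometry e
    have hz : ((z ^ f e : Circle) : ℂ) * star ((z ^ f e : Circle) : ℂ) = 1 := by
      rw [Complex.star_def, Complex.mul_conj, Circle.normSq_coe, Complex.ofReal_one]
    rw [star_smul, smul_mul_smul_comm, hz, one_smul, mul_smul_comm, h]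
  orthogonal_ranges e g h := by
    simp only [star_smul, smul_mul_assoc, mul_smul_comm, smul_smul]
    rw [F.orthogonal_ranges e g h, smul_zero]
  projection := F.projection
  orthogonal := F.orthogonal
  ck1 e := by
    have hz : star ((z ^ f e : Circle) : ℂ) * ((z ^ f e : Circle) : ℂ) = 1 := by
      rw [mul_comm, Complex.star_def, Complex.mul_conj, Circle.normSq_coe, Complex.ofReal_one]
    rw [star_smul, smul_mul_smul_comm, hz, one_smul, F.ck1]
  ck2 x h := by
    rw [F.ck2 x h]
    refine Finset.sum_congr rfl fun e _ => ?_
    have hz : ((z ^ f e : Circle) : ℂ) * star ((z ^ f e : Circle) : ℂ) = 1 := by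
      rw [Complex.star_def, Complex.mul_conj, Circle.normSq_coe, Complex.ofReal_one]
    rw [star_smul, smul_mul_smul_comm, hz, one_smul]

end CKFamily

/-! ## The graph C⋆-algebra

A C⋆-algebra generated by countably many elements is separable, so it has at most continuum many
elements and is isomorphic to one whose underlying set is a set of real numbers. These form a small
collection, so the product of all Cuntz–Krieger families in such C⋆-algebras makes sense, and it
generates the universal C⋆-algebra; `exists_lift`, `hom_ext` and `adjoin_universal` below state the
universal property, for targets in every universe. -/

/-- A C⋆-algebra whose underlying set is a set of real numbers (the operations and the norm are
arbitrary and have nothing to do with those of `ℝ`). -/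
structure SmallCStarAlgebra where
  carrier : Set ℝ
  inst : NonUnitalCStarAlgebra carrier

/-- The elements of a small C⋆-algebra. -/
def SmallCStarAlgebra.El (A : SmallCStarAlgebra) : Type := A.carrier

instance (A : SmallCStarAlgebra) : NonUnitalCStarAlgebra A.El := A.inst

/-- A Cuntz–Krieger family in a small C⋆-algebra. -/
structure SmallFamily (E : DirectedGraph.{u, v}) [E.RowFinite] where
  alg : SmallCStarAlgebra
  fam : CKFamily E alg.El

section Universal

variable (E : DirectedGraph.{u, v}) [E.RowFinite]

/-- The C⋆-algebra of all bounded families of elements, one for each small Cuntz–Krieger family. -/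
abbrev Ambient : Type (max u v) := lp (fun R : SmallFamily E => R.alg.El) ∞

/-- The element `(S_e)` of the product. -/
def ambientS (e : E.Edge) : Ambient E :=
  ⟨fun R => R.fam.S e, memℓp_infty ⟨1, by rintro _ ⟨R, rfl⟩; exact R.fam.norm_S_le e⟩⟩

/-- The element `(P_x)` of the product. -/
def ambientP (x : E.Vertex) : Ambient E :=
  ⟨fun R => R.fam.P x, memℓp_infty ⟨1, by rintro _ ⟨R, rfl⟩; exact R.fam.norm_P_le x⟩⟩

/-- Evaluation at one small family. -/
def ambientEval (R : SmallFamily E) : Ambient E →⋆ₙₐ[ℂ] R.alg.El where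
  toFun a := a R
  map_smul' _ _ := rfl
  map_zero' := rfl
  map_add' _ _ := rfl
  map_mul' _ _ := rfl
  map_star' _ := rfl

variable {E} in
theorem ambient_ext {a b : Ambient E} (h : ∀ R, ambientEval E R a = ambientEval E R b) : a = b :=
  lp.ext (funext h)

/-- The product of all small Cuntz–Krieger families. -/
def ambientFamily : CKFamily E (Ambient E) where
  S := ambientS E
  P := ambientP E
  partialIsometry e := ambient_ext fun R => by
    simp only [map_mul, map_star]; exact R.fam.partialIsometry e
  orthogonal_ranges e f h := ambient_ext fun R => by
    simp only [map_mul, map_star, map_zero]; exact R.fam.orthogonal_ranges e f h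
  projection x := ⟨ambient_ext fun R => by
      simp only [map_mul]; exact (R.fam.projection x).isIdempotentElem,
    ambient_ext fun R => by
      simp only [map_star]; exact (R.fam.projection x).isSelfAdjoint⟩
  orthogonal x y h := ambient_ext fun R => by
    simp only [map_mul, map_zero]; exact R.fam.orthogonal x y h
  ck1 e := ambient_ext fun R => by
    simp only [map_mul, map_star]; exact R.fam.ck1 e
  ck2 x h := ambient_ext fun R => by
    simp only [map_sum, map_mul, map_star]; exact R.fam.ck2 x h

/-- The graph C⋆-algebra `C⋆(E)`, as a closed ⋆-subalgebra of the product. -/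
def graphSubalgebra : NonUnitalStarSubalgebra ℂ (Ambient E) :=
  (NonUnitalStarAlgebra.adjoin ℂ (ambientFamily E).gens).topologicalClosure

instance : IsClosed (graphSubalgebra E : Set (Ambient E)) :=
  NonUnitalStarSubalgebra.isClosed_topologicalClosure _

/-- The graph C⋆-algebra `C⋆(E)` of a row-finite directed graph. -/
def GraphAlgebra : Type (max u v) := graphSubalgebra E

instance : NonUnitalCStarAlgebra (GraphAlgebra E) :=
  inferInstanceAs (NonUnitalCStarAlgebra (graphSubalgebra E))

theorem gens_subset_graphSubalgebra :
    (ambientFamily E).gens ⊆ (graphSubalgebra E : Set (Ambient E)) :=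
  (NonUnitalStarAlgebra.subset_adjoin ℂ _).trans
    (NonUnitalStarSubalgebra.le_topologicalClosure _)

/-- The inclusion of `C⋆(E)` in the product. -/
def graphIncl : GraphAlgebra E →⋆ₙₐ[ℂ] Ambient E :=
  NonUnitalStarSubalgebraClass.subtype (graphSubalgebra E)

/-- The universal Cuntz–Krieger family `{s, p}` that generates `C⋆(E)`. -/
def universalFamily : CKFamily E (GraphAlgebra E) :=
  (ambientFamily E).comap (graphIncl E) Subtype.val_injective
    (fun e => ⟨_, gens_subset_graphSubalgebra E (CKFamily.S_mem_gens _ e)⟩)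
    (fun x => ⟨_, gens_subset_graphSubalgebra E (CKFamily.P_mem_gens _ x)⟩)
    (fun _ => rfl) (fun _ => rfl)

end Universal

section Separable

variable {B : Type w} [NonUnitalCStarAlgebra B]

theorem countable_subsemigroup_closure {X : Set B} (hX : X.Countable) :
    (Subsemigroup.closure X : Set B).Countable := by
  have := hX.to_subtype
  let φ : FreeSemigroup X →ₙ* B := FreeSemigroup.lift Subtype.val
  have hinj : Function.Injective fun a : FreeSemigroup X => (a.head, a.tail) := by
    rintro ⟨a, l⟩ ⟨b, m⟩ h
    simpa using h
  have : Countable (FreeSemigroup X) := hinj.countable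
  refine (Set.countable_range φ).mono ?_
  have hle : Subsemigroup.closure X ≤ φ.srange :=
    Subsemigroup.closure_le.2 fun x hx => ⟨FreeSemigroup.of ⟨x, hx⟩, rfl⟩
  exact hle

theorem isSeparable_closure_adjoin {X : Set B} (hX : X.Countable) :
    TopologicalSpace.IsSeparable
      ((NonUnitalStarAlgebra.adjoin ℂ X).topologicalClosure : Set B) := by
  have h1 : (X ∪ star X).Countable :=
    hX.union (by simpa using hX.preimage star_injective)
  have h2 := (countable_subsemigroup_closure h1).isSeparable.span (R := ℂ)
  rw [← NonUnitalStarAlgebra.adjoin_eq_span] at h2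
  exact h2.closure

theorem exists_injective_real (D : Type w) [MetricSpace D] [TopologicalSpace.SeparableSpace D] :
    ∃ f : D → ℝ, Function.Injective f := by
  obtain ⟨c, hc, hd⟩ := TopologicalSpace.exists_countable_dense D
  have := hc.to_subtype
  obtain ⟨i, hi⟩ := exists_injective_nat c
  let g : D → Set (ℕ × ℕ) := fun d => {p | ∃ x : c, i x = p.1 ∧ dist d x < 1 / ((p.2 : ℝ) + 1)}
  have hg : Function.Injective g := by
    intro a b hab
    refine dist_le_zero.1 (le_of_forall_pos_le_add fun ε hε => ?_)
    obtain ⟨n, hn⟩ := exists_nat_one_div_lt (half_pos hε)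
    obtain ⟨x, hx, hax⟩ := Metric.dense_iff.1 hd a (1 / ((n : ℝ) + 1)) Nat.one_div_pos_of_nat
    have ha : (i ⟨x, hax⟩, n) ∈ g a := ⟨⟨x, hax⟩, rfl, by rwa [dist_comm]⟩
    rw [hab] at ha
    obtain ⟨y, hy, hby⟩ := ha
    obtain rfl := hi hy
    have h1 : dist x a < 1 / ((n : ℝ) + 1) := hx
    have h2 : dist b x < 1 / ((n : ℝ) + 1) := hby
    have h3 := dist_triangle a x b
    rw [dist_comm a x, dist_comm x b] at h3
    linarith
  have hcard : Cardinal.mk (Set (ℕ × ℕ)) = Cardinal.mk ℝ := by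
    rw [Cardinal.mk_real, Cardinal.mk_set]
    simp
  obtain ⟨e⟩ := Cardinal.eq.1 hcard
  exact ⟨e ∘ g, e.injective.comp hg⟩

/-- Transport a C⋆-algebra structure along a bijection. -/
theorem exists_transport {C : Type w'} {D : Type w} [NonUnitalCStarAlgebra D] (e : C ≃ D) :
    ∃ _ : NonUnitalCStarAlgebra C, Nonempty (C ≃⋆ₐ[ℂ] D) := by
  let ring : NonUnitalRing C := e.nonUnitalRing
  let nring : NonUnitalNormedRing C := .induced C D e.ringEquiv e.injective
  let star : StarRing C := e.starRing
  let mod : Module ℂ C := e.module ℂ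
  have hadd : ∀ a b, e (a + b) = e a + e b := fun a b => e.apply_symm_apply _
  have hmul : ∀ a b, e (a * b) = e a * e b := fun a b => e.apply_symm_apply _
  have hstar : ∀ a, e (Star.star a) = Star.star (e a) := fun a => e.apply_symm_apply _
  have hsmul : ∀ (c : ℂ) a, e (c • a) = c • e a := fun c a => e.apply_symm_apply _
  have hnorm : ∀ a, ‖a‖ = ‖e a‖ := fun a => rfl
  let nsp : NormedSpace ℂ C := ⟨fun c a => by rw [hnorm, hnorm, hsmul, norm_smul]⟩
  have hiso : Isometry e := Isometry.of_dist_eq fun a b => rfl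
  let ie : C ≃ᵢ D := ⟨e, hiso⟩
  have hcomp : CompleteSpace C := ie.completeSpace
  have hcstar : CStarRing C := ⟨fun a => by
    rw [hnorm, hnorm, hmul, hstar, CStarRing.norm_star_mul_self]⟩
  have htower : IsScalarTower ℂ C C := ⟨fun c a b => e.injective (by
    simp only [smul_eq_mul, hmul, hsmul, smul_mul_assoc])⟩
  have hcomm : SMulCommClass ℂ C C := ⟨fun c a b => e.injective (by
    simp only [smul_eq_mul, hmul, hsmul, mul_smul_comm])⟩
  have hsm : StarModule ℂ C := ⟨fun c a => e.injective (by
    simp only [hstar, hsmul, star_smul])⟩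
  exact ⟨{ nring, star, nsp with
      complete := hcomp.complete
      norm_mul_self_le := hcstar.norm_mul_self_le
      smul_assoc := htower.smul_assoc
      smul_comm := hcomm.smul_comm
      star_smul := hsm.star_smul }, ⟨{ e with
    map_mul' := hmul
    map_add' := hadd
    map_star' := hstar
    map_smul' := hsmul }⟩⟩

/-- A separable C⋆-algebra is isomorphic to a small one. -/
theorem exists_small (D : Type w) [NonUnitalCStarAlgebra D] [TopologicalSpace.SeparableSpace D] :
    ∃ A : SmallCStarAlgebra, Nonempty (A.El ≃⋆ₐ[ℂ] D) := by
  obtain ⟨f, hf⟩ := exists_injective_real D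
  obtain ⟨i, e⟩ := exists_transport (Equiv.ofInjective f hf).symm
  exact ⟨⟨Set.range f, i⟩, e⟩

end Separable

section UniversalProperty

variable {E : DirectedGraph.{u, v}} [E.RowFinite]

/-- `C⋆(E)` is generated by its universal family. -/
theorem adjoin_universal :
    (NonUnitalStarAlgebra.adjoin ℂ (universalFamily E).gens).topologicalClosure = ⊤ := by
  refine eq_top_iff.2 fun a _ => ?_
  have himg : graphIncl E '' (universalFamily E).gens = (ambientFamily E).gens := by
    rw [CKFamily.gens, Set.image_union, ← Set.range_comp, ← Set.range_comp]
    rfl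
  have hmap := NonUnitalStarAlgHom.map_adjoin (graphIncl E) (universalFamily E).gens
  rw [himg] at hmap
  have hind : Topology.IsInducing (graphIncl E) := ⟨rfl⟩
  have ha : graphIncl E a ∈ closure
      (NonUnitalStarAlgebra.adjoin ℂ (ambientFamily E).gens : Set (Ambient E)) := a.2
  rw [← hmap] at ha
  change a ∈ closure (NonUnitalStarAlgebra.adjoin ℂ (universalFamily E).gens :
    Set (GraphAlgebra E))
  rw [hind.closure_eq_preimage_closure_image]
  exact ha

/-- A ⋆-homomorphism on `C⋆(E)` is determined by its values on the generators. -/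
theorem hom_ext {B : Type w} [NonUnitalCStarAlgebra B] {φ ψ : GraphAlgebra E →⋆ₙₐ[ℂ] B}
    (hS : ∀ e, φ ((universalFamily E).S e) = ψ ((universalFamily E).S e))
    (hP : ∀ x, φ ((universalFamily E).P x) = ψ ((universalFamily E).P x)) : φ = ψ := by
  have hle : NonUnitalStarAlgebra.adjoin ℂ (universalFamily E).gens ≤
      NonUnitalStarAlgHom.equalizer φ ψ := by
    refine NonUnitalStarAlgebra.adjoin_le ?_
    rintro _ (⟨e, rfl⟩ | ⟨x, rfl⟩)
    exacts [hS e, hP x]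
  have hcont : ∀ χ : GraphAlgebra E →⋆ₙₐ[ℂ] B, Continuous χ := fun χ =>
    AddMonoidHomClass.continuous_of_bound χ 1 fun a => by
      simpa using NonUnitalStarAlgHom.norm_apply_le χ a
  have hcl : IsClosed (NonUnitalStarAlgHom.equalizer φ ψ : Set (GraphAlgebra E)) :=
    isClosed_eq (hcont φ) (hcont ψ)
  have h := NonUnitalStarSubalgebra.topologicalClosure_minimal _ hle hcl
  rw [adjoin_universal] at h
  ext a
  exact h (NonUnitalStarAlgebra.mem_top (x := a))

/-- The universal property: every Cuntz–Krieger `E`-family in a C⋆-algebra is the image of the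
universal one. -/
theorem exists_lift {B : Type w} [NonUnitalCStarAlgebra B] (F : CKFamily E B) :
    ∃ φ : GraphAlgebra E →⋆ₙₐ[ℂ] B, (∀ e, φ ((universalFamily E).S e) = F.S e) ∧
      ∀ x, φ ((universalFamily E).P x) = F.P x := by
  let D := (NonUnitalStarAlgebra.adjoin ℂ F.gens).topologicalClosure
  have hD : IsClosed (D : Set B) := NonUnitalStarSubalgebra.isClosed_topologicalClosure _
  have hsub : F.gens ⊆ (D : Set B) := (NonUnitalStarAlgebra.subset_adjoin ℂ _).trans
    (NonUnitalStarSubalgebra.le_topologicalClosure _)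
  have hsep : TopologicalSpace.SeparableSpace D :=
    (isSeparable_closure_adjoin F.countable_gens).separableSpace
  obtain ⟨A, ⟨e⟩⟩ := exists_small D
  let ι : A.El →⋆ₙₐ[ℂ] B :=
    (NonUnitalStarSubalgebraClass.subtype D).comp (e : A.El →⋆ₙₐ[ℂ] D)
  have hι : Function.Injective ι := Subtype.val_injective.comp e.injective
  have hval : ∀ d : D, ι (e.symm d) = d := fun d => congrArg Subtype.val (e.apply_symm_apply d)
  let R : SmallFamily E := ⟨A, F.comap ι hι
    (fun g => e.symm ⟨_, hsub (F.S_mem_gens g)⟩) (fun x => e.symm ⟨_, hsub (F.P_mem_gens x)⟩)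
    (fun _ => hval _) (fun _ => hval _)⟩
  exact ⟨ι.comp ((ambientEval E R).comp (graphIncl E)), fun _ => hval _, fun _ => hval _⟩

/-- The ⋆-homomorphism on `C⋆(E)` induced by a Cuntz–Krieger family. -/
def lift {B : Type w} [NonUnitalCStarAlgebra B] (F : CKFamily E B) : GraphAlgebra E →⋆ₙₐ[ℂ] B :=
  (exists_lift F).choose

@[simp]
theorem lift_S {B : Type w} [NonUnitalCStarAlgebra B] (F : CKFamily E B) (e : E.Edge) :
    lift F ((universalFamily E).S e) = F.S e :=
  (exists_lift F).choose_spec.1 e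

@[simp]
theorem lift_P {B : Type w} [NonUnitalCStarAlgebra B] (F : CKFamily E B) (x : E.Vertex) :
    lift F ((universalFamily E).P x) = F.P x :=
  (exists_lift F).choose_spec.2 x

end UniversalProperty

/-! ## Weighted gauge actions and the diagonal -/

/-- The weighted gauge action with edge function `f`: the ⋆-endomorphism `γ_z` of `C⋆(E)` with
`γ_z (s_e) = z ^ f e • s_e` and `γ_z (p_x) = p_x`. -/
def gauge (E : DirectedGraph.{u, v}) [E.RowFinite] (f : E.Edge → ℤ) (z : Circle) :
    GraphAlgebra E →⋆ₙₐ[ℂ] GraphAlgebra E :=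
  lift ((universalFamily E).twist f z)

theorem gauge_S (E : DirectedGraph.{u, v}) [E.RowFinite] (f : E.Edge → ℤ) (z : Circle)
    (e : E.Edge) : gauge E f z ((universalFamily E).S e) =
      (z : ℂ) ^ f e • (universalFamily E).S e := by
  rw [gauge, lift_S, ← Circle.coe_zpow]
  rfl

theorem gauge_P (E : DirectedGraph.{u, v}) [E.RowFinite] (f : E.Edge → ℤ) (z : Circle)
    (x : E.Vertex) : gauge E f z ((universalFamily E).P x) = (universalFamily E).P x := by
  rw [gauge, lift_P]
  rfl

theorem gauge_one (E : DirectedGraph.{u, v}) [E.RowFinite] (f : E.Edge → ℤ) :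
    gauge E f 1 = NonUnitalStarAlgHom.id ℂ (GraphAlgebra E) :=
  hom_ext (fun e => by simp [gauge_S]) (fun x => by simp [gauge_P])

theorem gauge_mul (E : DirectedGraph.{u, v}) [E.RowFinite] (f : E.Edge → ℤ) (z z' : Circle) :
    gauge E f (z * z') = (gauge E f z).comp (gauge E f z') :=
  hom_ext (fun e => by simp [gauge_S, map_smul, mul_zpow, smul_smul, mul_comm])
    (fun x => by simp [gauge_P])

/-- The diagonal subalgebra `D(E)`: the closed ⋆-subalgebra of `C⋆(E)` generated by the range
projections `s_μ s_μ⋆` of all finite paths `μ`. -/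
def diagonal (E : DirectedGraph.{u, v}) [E.RowFinite] : NonUnitalStarSubalgebra ℂ (GraphAlgebra E) :=
  (NonUnitalStarAlgebra.adjoin ℂ
    {a | ∃ (x : E.Vertex) (μ : FinitePath E x),
      a = (universalFamily E).path μ * star ((universalFamily E).path μ)}).topologicalClosure

/-! ## In-splits -/

/-- The data of an in-split: for every vertex `x` a partition of `r⁻¹(x)` into `m x` non-empty sets
`part x i`. If `x` is a source, the conditions force `m x = 0`; otherwise they force `m x ≥ 1`. -/
structure InSplit (E : DirectedGraph.{u, v}) where
  m : E.Vertex → ℕ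
  part : (x : E.Vertex) → Fin (m x) → Set E.Edge
  nonempty : ∀ x i, (part x i).Nonempty
  disjoint : ∀ x i j, i ≠ j → Disjoint (part x i) (part x j)
  iUnion_part : ∀ x, ⋃ i, part x i = E.r ⁻¹' {x}

namespace InSplit

variable {E : DirectedGraph.{u, v}} (σ : InSplit E)

/-- The in-split is proper: at a vertex that receives infinitely many edges exactly one of the
(finitely many) partition sets is infinite. -/
def IsProper : Prop :=
  ∀ x, (E.r ⁻¹' {x}).Infinite → ∃! i, (σ.part x i).Infinite

theorem exists_index (e : E.Edge) : ∃ i, e ∈ σ.part (E.r e) i := by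
  have h : e ∈ ⋃ i, σ.part (E.r e) i := by rw [σ.iUnion_part]; rfl
  simpa using h

/-- The index `i` of the partition set of `r⁻¹(r e)` that contains `e`. -/
def index (e : E.Edge) : Fin (σ.m (E.r e)) := (σ.exists_index e).choose

theorem mem_part_index (e : E.Edge) : e ∈ σ.part (E.r e) (σ.index e) :=
  (σ.exists_index e).choose_spec

theorem index_eq {e : E.Edge} {i : Fin (σ.m (E.r e))} (h : e ∈ σ.part (E.r e) i) :
    σ.index e = i := by
  by_contra hne
  exact Set.disjoint_left.1 (σ.disjoint _ _ _ hne) (σ.mem_part_index e) h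

theorem m_eq_zero_iff (x : E.Vertex) : σ.m x = 0 ↔ E.IsSource x := by
  constructor
  · intro h
    have : IsEmpty (Fin (σ.m x)) := by rw [h]; infer_instance
    rw [DirectedGraph.IsSource, ← σ.iUnion_part, Set.iUnion_of_empty]
  · intro h
    by_contra hm
    obtain ⟨e, he⟩ := σ.nonempty x ⟨0, Nat.pos_of_ne_zero hm⟩
    have : e ∈ E.r ⁻¹' {x} := by
      rw [← σ.iUnion_part]; exact Set.mem_iUnion_of_mem _ he
    rw [h] at this
    exact this

/-- The in-split graph. Its vertices are `x_i` with `i < m x` (left summand) and `x` with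
`m x = 0` (right summand); its edges are `e_j` with `j < m (s e)` and `e` with `m (s e) = 0`. Copies
of `e` start at the corresponding copy of `s e` and end at the copy of `r e` with index
`index e`. -/
def graph : DirectedGraph.{u, v} where
  Vertex := (Σ x : E.Vertex, Fin (σ.m x)) ⊕ {x : E.Vertex // σ.m x = 0}
  Edge := (Σ e : E.Edge, Fin (σ.m (E.s e))) ⊕ {e : E.Edge // σ.m (E.s e) = 0}
  countable_vertex := inferInstance
  countable_edge := inferInstance
  s
    | .inl ⟨e, j⟩ => .inl ⟨E.s e, j⟩
    | .inr ⟨e, h⟩ => .inr ⟨E.s e, h⟩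
  r
    | .inl ⟨e, _⟩ => .inl ⟨E.r e, σ.index e⟩
    | .inr ⟨e, _⟩ => .inl ⟨E.r e, σ.index e⟩

/-- An in-split graph of a row-finite graph is row-finite. -/
instance [E.RowFinite] : σ.graph.RowFinite where
  finite_preimage y := by
    rcases y with ⟨x, i⟩ | ⟨x, hx⟩
    · have hfin := DirectedGraph.RowFinite.finite_preimage x
      have := hfin.to_subtype
      refine Set.Finite.subset
        ((Set.finite_range fun p : Σ e : E.r ⁻¹' {x}, Fin (σ.m (E.s e)) =>
            (Sum.inl ⟨p.1, p.2⟩ : σ.graph.Edge)).union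
          (Set.finite_range fun p : {e : E.r ⁻¹' {x} // σ.m (E.s e) = 0} =>
            (Sum.inr ⟨p.1, p.2⟩ : σ.graph.Edge))) ?_
      rintro (⟨e, j⟩ | ⟨e, h⟩) he
      · have hx : E.r e = x := congrArg Sigma.fst (Sum.inl.inj he)
        exact Or.inl ⟨⟨⟨e, hx⟩, j⟩, rfl⟩
      · have hx : E.r e = x := congrArg Sigma.fst (Sum.inl.inj he)
        exact Or.inr ⟨⟨⟨e, hx⟩, h⟩, rfl⟩
    · refine Set.Finite.subset Set.finite_empty ?_
      rintro (⟨e, j⟩ | ⟨e, h⟩) he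
      · exact absurd he Sum.inl_ne_inr
      · exact absurd he Sum.inl_ne_inr

end InSplit

end GraphCStar

end

/-!
Write `E₂` for the in-split graph of `E`, and call `x_i` and `e_j` the copies of `x` and `e`. The
isomorphism `C⋆(E) → C⋆(E₂)` sends `p_x` and `s_e` to the sums of the generators of their copies.
These sums form a Cuntz–Krieger family (`mergeFamily`): the copies of `e` start at distinct vertices,
namely once at each copy of `s e`, so all mixed terms vanish, and the edges that end at the copies
of `x` are precisely the copies of the edges that end at `x`.

The inverse is explicit, so no uniqueness theorem is needed. The partition set `part x i` gives the
projection `∑ e ∈ part x i, s_e s_e⋆` of `C⋆(E)`, and these projections add up to `p_x`. Sending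
`p_{x_i}` to it (and the copy of a source to its vertex projection), and `s_a`, for a copy `a` of
`e`, to `s_e` cut down by the projection of the source of `a`, is a Cuntz–Krieger `E₂`-family
(`splitFamily`). The two homomorphisms are mutually inverse on generators.

For the diagonals, each homomorphism maps one diagonal into the other. By
`map_mem_of_mem_diagonal` it suffices that the target diagonal contains the images of the `p_x` and
is stable under conjugation by the images of the `s_e`. A diagonal is stable under conjugation by
its own generators (`conj_S_mem_diagonal`). For the image of `s_e` in `C⋆(E₂)` the mixed terms of
the conjugation vanish because the diagonal commutes with the vertex projections; the images of the
edge generators in `C⋆(E)` are the `s_e` cut down by projections of the diagonal.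

Finally, if every copy of `e` gets the weight `f e`, the isomorphism intertwines the gauge actions,
since each summand of the image of `s_e` is scaled by the same `z ^ f e`.
-/

noncomputable section

open scoped Classical

namespace GraphCStar

/-! ### Relations in a Cuntz–Krieger family -/

/-- A product of two sums over the same index set with vanishing off-diagonal terms. -/
theorem sum_mul_sum_eq_sum_diag {ι B : Type*} [NonUnitalSemiring B] (t : Finset ι) (f g : ι → B)
    (h : ∀ a ∈ t, ∀ b ∈ t, a ≠ b → f a * g b = 0) :
    (∑ a ∈ t, f a) * ∑ b ∈ t, g b = ∑ a ∈ t, f a * g a := by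
  rw [Finset.sum_mul_sum]
  refine Finset.sum_congr rfl fun a ha => Finset.sum_eq_single a (fun b hb hba => ?_) ?_
  · exact h a ha b hb hba.symm
  · exact fun hn => absurd ha hn

theorem DirectedGraph.not_isSource_r (E : DirectedGraph.{u, v}) (e : E.Edge) :
    ¬ E.IsSource (E.r e) := fun h => by
  have he : e ∈ E.r ⁻¹' {E.r e} := rfl
  rw [DirectedGraph.IsSource] at h
  rwa [h] at he

namespace CKFamily

variable {E : DirectedGraph.{u, v}} [E.RowFinite] {B : Type w} [NonUnitalCStarAlgebra B]
  (F : CKFamily E B)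

theorem star_P (x : E.Vertex) : star (F.P x) = F.P x := (F.projection x).isSelfAdjoint.star_eq

theorem P_mul_P (x : E.Vertex) : F.P x * F.P x = F.P x := (F.projection x).isIdempotentElem.eq

theorem S_mul_P (e : E.Edge) : F.S e * F.P (E.s e) = F.S e := by
  rw [← F.ck1, ← mul_assoc, F.partialIsometry]

theorem P_mul_star_S (e : E.Edge) : F.P (E.s e) * star (F.S e) = star (F.S e) := by
  simpa only [star_mul, F.star_P] using congrArg star (F.S_mul_P e)

theorem S_mul_P_of_ne {e : E.Edge} {x : E.Vertex} (h : E.s e ≠ x) : F.S e * F.P x = 0 := by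
  rw [← F.S_mul_P e, mul_assoc, F.orthogonal _ _ h, mul_zero]

theorem star_S_mul_S_of_ne {e f : E.Edge} (h : e ≠ f) : star (F.S e) * F.S f = 0 := by
  have he : star (F.S e) * (F.S e * star (F.S e)) = star (F.S e) := by
    simpa only [star_mul, star_star, mul_assoc] using congrArg star (F.partialIsometry e)
  calc star (F.S e) * F.S f
      = star (F.S e) * (F.S e * star (F.S e)) * (F.S f * star (F.S f) * F.S f) := by
        rw [he, F.partialIsometry]
    _ = star (F.S e) * ((F.S e * star (F.S e)) * (F.S f * star (F.S f))) * F.S f := by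
        simp only [mul_assoc]
    _ = 0 := by rw [F.orthogonal_ranges e f h, mul_zero, zero_mul]

theorem P_mul_S (e : E.Edge) : F.P (E.r e) * F.S e = F.S e := by
  rw [F.ck2 _ (E.not_isSource_r e), Finset.sum_mul, Finset.sum_eq_single e]
  · exact F.partialIsometry e
  · intro f _ hf
    rw [mul_assoc, F.star_S_mul_S_of_ne hf, mul_zero]
  · intro h
    exact absurd ((E.mem_into _ _).2 rfl) h

theorem P_mul_S_of_ne {e : E.Edge} {x : E.Vertex} (h : x ≠ E.r e) : F.P x * F.S e = 0 := by
  rw [← F.P_mul_S e, ← mul_assoc, F.orthogonal _ _ h, zero_mul]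

theorem isStarProjection_range (e : E.Edge) : IsStarProjection (F.S e * star (F.S e)) :=
  ⟨by rw [IsIdempotentElem, ← mul_assoc, F.partialIsometry], .mul_star_self _⟩

/-- An element that commutes with the vertex projections lies between `S e` and `star (S f)` only
if the two edges start at the same vertex. -/
theorem S_mul_mul_star_S_of_ne {e f : E.Edge} (h : E.s e ≠ E.s f) {d : B}
    (hd : Commute (F.P (E.s e)) d) : F.S e * d * star (F.S f) = 0 := by
  rw [← F.S_mul_P e, ← F.P_mul_star_S f, mul_assoc (F.S e), hd.eq]
  simp only [← mul_assoc]
  rw [mul_assoc _ (F.P (E.s e)), F.orthogonal _ _ h, mul_zero, zero_mul]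

theorem S_mul_star_S_of_ne {e f : E.Edge} (h : E.s e ≠ E.s f) : F.S e * star (F.S f) = 0 := by
  rw [← F.S_mul_P e, ← F.P_mul_star_S f, mul_assoc, ← mul_assoc (F.P _), F.orthogonal _ _ h,
    zero_mul, mul_zero]

theorem P_mul_path (x : E.Vertex) : ∀ {y : E.Vertex} (μ : FinitePath E y),
    F.P x * F.path μ = if x = y then F.path μ else 0
  | _, .vertex y => by
    rw [path]
    split_ifs with h
    · rw [h, F.P_mul_P]
    · exact F.orthogonal _ _ h
  | _, .cons e μ => by
    rw [path, ← mul_assoc]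
    split_ifs with h
    · rw [h, F.P_mul_S]
    · rw [F.P_mul_S_of_ne h, zero_mul]

theorem commute_P_path_mul_star_path (x : E.Vertex) {y : E.Vertex} (μ : FinitePath E y) :
    Commute (F.P x) (F.path μ * star (F.path μ)) := by
  have h : F.P x * (F.path μ * star (F.path μ)) =
      if x = y then F.path μ * star (F.path μ) else 0 := by
    rw [← mul_assoc, F.P_mul_path, ite_mul, zero_mul]
  have h' := congrArg star h
  rw [star_mul, F.star_P, apply_ite star, star_zero, star_mul, star_star] at h'
  exact h.trans h'.symm

end CKFamily

/-! ### The diagonal subalgebra -/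

section Diagonal

variable {E : DirectedGraph.{u, v}} [E.RowFinite]

theorem continuous_starHom {A : Type w} {B : Type w'} [NonUnitalCStarAlgebra A]
    [NonUnitalCStarAlgebra B] (φ : A →⋆ₙₐ[ℂ] B) : Continuous φ :=
  AddMonoidHomClass.continuous_of_bound φ 1 fun a => by
    simpa using NonUnitalStarAlgHom.norm_apply_le φ a

theorem isClosed_diagonal : IsClosed (diagonal E : Set (GraphAlgebra E)) :=
  NonUnitalStarSubalgebra.isClosed_topologicalClosure _

theorem path_mul_star_path_mem_diagonal {x : E.Vertex} (μ : FinitePath E x) :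
    (universalFamily E).path μ * star ((universalFamily E).path μ) ∈ diagonal E :=
  NonUnitalStarSubalgebra.le_topologicalClosure _
    (NonUnitalStarAlgebra.subset_adjoin ℂ _ ⟨x, μ, rfl⟩)

theorem diagonal_le {T : NonUnitalStarSubalgebra ℂ (GraphAlgebra E)}
    (hT : IsClosed (T : Set (GraphAlgebra E)))
    (h : ∀ {x : E.Vertex} (μ : FinitePath E x),
      (universalFamily E).path μ * star ((universalFamily E).path μ) ∈ T) : diagonal E ≤ T := by
  refine NonUnitalStarSubalgebra.topologicalClosure_minimal _
    (NonUnitalStarAlgebra.adjoin_le ?_) hT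
  rintro _ ⟨x, μ, rfl⟩
  exact h μ

theorem P_mem_diagonal (x : E.Vertex) : (universalFamily E).P x ∈ diagonal E := by
  have h := path_mul_star_path_mem_diagonal (FinitePath.vertex x)
  rwa [CKFamily.path, CKFamily.star_P, CKFamily.P_mul_P] at h

theorem S_mul_star_S_mem_diagonal (e : E.Edge) :
    (universalFamily E).S e * star ((universalFamily E).S e) ∈ diagonal E := by
  have h := path_mul_star_path_mem_diagonal (FinitePath.cons e (.vertex (E.s e)))
  rwa [CKFamily.path, CKFamily.path, CKFamily.S_mul_P] at h

theorem commute_P_of_mem_diagonal (x : E.Vertex) {d : GraphAlgebra E} (hd : d ∈ diagonal E) :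
    Commute ((universalFamily E).P x) d := by
  have hle : diagonal E ≤
      NonUnitalStarSubalgebra.centralizer ℂ {(universalFamily E).P x} := by
    refine diagonal_le (Set.isClosed_centralizer _) fun μ => ?_
    rw [NonUnitalStarSubalgebra.mem_centralizer_iff]
    rintro _ rfl
    rw [CKFamily.star_P]
    exact ⟨CKFamily.commute_P_path_mul_star_path _ _ μ,
      CKFamily.commute_P_path_mul_star_path _ _ μ⟩
  exact ((NonUnitalStarSubalgebra.mem_centralizer_iff _).1 (hle hd) _ rfl).1

/-- The diagonal is stable under conjugation by the generators `s_e`. -/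
theorem conj_S_mem_diagonal (e : E.Edge) {d : GraphAlgebra E} (hd : d ∈ diagonal E) :
    (universalFamily E).S e * d * star ((universalFamily E).S e) ∈ diagonal E := by
  set s := (universalFamily E).S e
  -- On the elements that commute with `s_e⋆ s_e`, conjugation by `s_e` is multiplicative.
  let T : NonUnitalStarSubalgebra ℂ (GraphAlgebra E) :=
    { carrier := {a | a ∈ diagonal E ∧ s * a * star s ∈ diagonal E}
      zero_mem' := ⟨zero_mem _, by rw [mul_zero, zero_mul]; exact zero_mem _⟩
      add_mem' := fun ha hb => ⟨add_mem ha.1 hb.1, by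
        rw [mul_add, add_mul]; exact add_mem ha.2 hb.2⟩
      smul_mem' := fun c a ha => ⟨SMulMemClass.smul_mem c ha.1, by
        rw [mul_smul_comm, smul_mul_assoc]; exact SMulMemClass.smul_mem c ha.2⟩
      star_mem' := fun {a} ha => ⟨star_mem ha.1, by
        have h := star_mem (S := NonUnitalStarSubalgebra ℂ (GraphAlgebra E)) ha.2
        rwa [star_mul, star_mul, star_star, ← mul_assoc] at h⟩
      mul_mem' := fun {a b} ha hb => ⟨mul_mem ha.1 hb.1, by
        have h : s * (a * b) * star s = (s * a * star s) * (s * b * star s) := by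
          have hc := commute_P_of_mem_diagonal (E.s e) hb.1
          calc s * (a * b) * star s
              = s * a * b * ((universalFamily E).P (E.s e) * star s) := by
                rw [CKFamily.P_mul_star_S, mul_assoc s a b]
            _ = s * a * (b * (universalFamily E).P (E.s e)) * star s := by
                simp only [mul_assoc]
            _ = _ := by
                rw [← hc.eq, ← (universalFamily E).ck1]
                simp only [mul_assoc, s]
        rw [h]
        exact mul_mem ha.2 hb.2⟩ }
  have hT : IsClosed (T : Set (GraphAlgebra E)) :=
    isClosed_diagonal.inter (isClosed_diagonal.preimage
      ((continuous_const.mul continuous_id).mul continuous_const))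
  refine (diagonal_le hT (fun {x} μ => ⟨path_mul_star_path_mem_diagonal μ, ?_⟩) hd).2
  by_cases hx : E.s e = x
  · subst hx
    have h := path_mul_star_path_mem_diagonal (FinitePath.cons e μ)
    rwa [CKFamily.path, star_mul, mul_assoc, ← mul_assoc _ (star _), ← mul_assoc] at h
  · have h0 : s * (universalFamily E).path μ = 0 := by
      simp only [s]
      rw [← CKFamily.S_mul_P, mul_assoc, CKFamily.P_mul_path, if_neg hx, mul_zero]
    rw [← mul_assoc, h0, zero_mul, zero_mul]
    exact zero_mem _

/-- A ⋆-homomorphism out of `C⋆(E)` maps the diagonal into a closed ⋆-subalgebra as soon as that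
subalgebra contains the images of the `p_x` and is stable under conjugation by the images of the
`s_e`. -/
theorem map_mem_of_mem_diagonal {B : Type w} [NonUnitalCStarAlgebra B]
    (φ : GraphAlgebra E →⋆ₙₐ[ℂ] B) {T : NonUnitalStarSubalgebra ℂ B}
    (hT : IsClosed (T : Set B)) (hP : ∀ x, φ ((universalFamily E).P x) ∈ T)
    (hS : ∀ e, ∀ d ∈ T, φ ((universalFamily E).S e) * d * star (φ ((universalFamily E).S e)) ∈ T)
    {a : GraphAlgebra E} (ha : a ∈ diagonal E) : φ a ∈ T := by
  have hpath : ∀ {x : E.Vertex} (μ : FinitePath E x),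
      φ ((universalFamily E).path μ * star ((universalFamily E).path μ)) ∈ T := by
    intro x μ
    induction μ with
    | vertex x =>
      rw [CKFamily.path, CKFamily.star_P, CKFamily.P_mul_P]
      exact hP x
    | cons e μ ih =>
      have h := hS e _ ih
      rwa [← map_star, ← map_mul, ← map_mul, ← mul_assoc, mul_assoc, ← star_mul] at h
  exact diagonal_le (T := T.comap φ) (hT.preimage (continuous_starHom φ)) hpath ha

end Diagonal

/-! ### Copies of vertices and edges in the in-split graph -/

namespace InSplit

variable {E : DirectedGraph.{u, v}} (σ : InSplit E)

/-- The vertex of `E` of which a vertex of the in-split graph is a copy. -/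
def baseVertex : σ.graph.Vertex → E.Vertex
  | .inl p => p.1
  | .inr x => x.1

/-- The edge of `E` of which an edge of the in-split graph is a copy. -/
def baseEdge : σ.graph.Edge → E.Edge
  | .inl p => p.1
  | .inr e => e.1

/-- The common range of all copies of the edge `e`. -/
def rangeCopy (e : E.Edge) : σ.graph.Vertex := .inl ⟨E.r e, σ.index e⟩

theorem baseVertex_s (a : σ.graph.Edge) : σ.baseVertex (σ.graph.s a) = E.s (σ.baseEdge a) := by
  rcases a with ⟨e, j⟩ | ⟨e, h⟩ <;> rfl

theorem r_eq_rangeCopy (a : σ.graph.Edge) : σ.graph.r a = σ.rangeCopy (σ.baseEdge a) := by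
  rcases a with ⟨e, j⟩ | ⟨e, h⟩ <;> rfl

theorem baseVertex_rangeCopy (e : E.Edge) : σ.baseVertex (σ.rangeCopy e) = E.r e := rfl

theorem m_range_ne_zero (e : E.Edge) : σ.m (E.r e) ≠ 0 := fun h =>
  E.not_isSource_r e ((σ.m_eq_zero_iff _).1 h)

theorem eq_of_baseVertex_eq {x y : σ.graph.Vertex} (h : σ.baseVertex x = σ.baseVertex y)
    (hx : σ.m (σ.baseVertex x) = 0) : x = y := by
  have hy := h ▸ hx
  rcases x with ⟨x, i⟩ | ⟨x, hx'⟩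
  · exact absurd i.2 (by have : σ.m x = 0 := hx; omega)
  · rcases y with ⟨y, j⟩ | ⟨y, hy'⟩
    · exact absurd j.2 (by have : σ.m y = 0 := hy; omega)
    · exact congrArg Sum.inr (Subtype.ext h)

theorem exists_baseVertex_eq {x : E.Vertex} (hx : σ.m x = 0) :
    ∃ y : σ.graph.Vertex, σ.baseVertex y = x := ⟨.inr ⟨x, hx⟩, rfl⟩

theorem isSource_iff (x : σ.graph.Vertex) : σ.graph.IsSource x ↔ σ.m (σ.baseVertex x) = 0 := by
  constructor
  · rcases x with ⟨x, i⟩ | ⟨x, hx⟩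
    · intro h
      obtain ⟨e, he⟩ := σ.nonempty x i
      have hr : e ∈ E.r ⁻¹' {x} := by
        rw [← σ.iUnion_part]; exact Set.mem_iUnion_of_mem _ he
      obtain rfl : E.r e = x := hr
      obtain rfl := σ.index_eq he
      have hr' : ∃ a : σ.graph.Edge, σ.baseEdge a = e := by
        by_cases hs : σ.m (E.s e) = 0
        · exact ⟨.inr ⟨e, hs⟩, rfl⟩
        · exact ⟨.inl ⟨e, ⟨0, Nat.pos_of_ne_zero hs⟩⟩, rfl⟩
      obtain ⟨a, rfl⟩ := hr'
      have ha := σ.graph.not_isSource_r a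
      rw [r_eq_rangeCopy] at ha
      exact absurd h ha
    · exact fun _ => hx
  · intro h
    refine Set.eq_empty_of_forall_notMem fun a ha => ?_
    obtain rfl : σ.graph.r a = x := ha
    rw [r_eq_rangeCopy, baseVertex_rangeCopy] at h
    exact σ.m_range_ne_zero _ h

/-- A copy of an edge is determined by the copy of its source at which it starts. -/
theorem edge_ext {a b : σ.graph.Edge} (h : σ.baseEdge a = σ.baseEdge b)
    (hs : σ.graph.s a = σ.graph.s b) : a = b := by
  rcases a with ⟨e, j⟩ | ⟨e, he⟩ <;> rcases b with ⟨f, k⟩ | ⟨f, hf⟩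
  · obtain rfl : e = f := h
    have hs' := eq_of_heq (Sigma.mk.inj (Sum.inl.inj hs)).2
    exact congrArg (fun i => (Sum.inl ⟨e, i⟩ : σ.graph.Edge)) hs'
  · exact absurd hs Sum.inl_ne_inr
  · exact absurd hs Sum.inr_ne_inl
  · exact congrArg Sum.inr (Subtype.ext h)

theorem exists_edge {e : E.Edge} {x : σ.graph.Vertex} (h : σ.baseVertex x = E.s e) :
    ∃ a : σ.graph.Edge, σ.baseEdge a = e ∧ σ.graph.s a = x := by
  rcases x with ⟨x, i⟩ | ⟨x, hx⟩
  · obtain rfl : x = E.s e := h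
    exact ⟨.inl ⟨e, i⟩, rfl, rfl⟩
  · obtain rfl : x = E.s e := h
    exact ⟨.inr ⟨e, hx⟩, rfl, rfl⟩

theorem finite_vertexCopies (x : E.Vertex) : (σ.baseVertex ⁻¹' {x}).Finite := by
  refine ((Set.finite_range fun i : Fin (σ.m x) => (Sum.inl ⟨x, i⟩ : σ.graph.Vertex)).union
    (Set.finite_range fun h : PLift (σ.m x = 0) =>
      (Sum.inr ⟨x, h.down⟩ : σ.graph.Vertex))).subset ?_
  rintro (⟨y, i⟩ | ⟨y, hy⟩) h
  · obtain rfl : y = x := h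
    exact Or.inl ⟨i, rfl⟩
  · obtain rfl : y = x := h
    exact Or.inr ⟨⟨hy⟩, rfl⟩

/-- The finite set of copies of a vertex. -/
def vertexCopies (x : E.Vertex) : Finset σ.graph.Vertex := (σ.finite_vertexCopies x).toFinset

@[simp]
theorem mem_vertexCopies {x : E.Vertex} {y : σ.graph.Vertex} :
    y ∈ σ.vertexCopies x ↔ σ.baseVertex y = x := by
  simp [vertexCopies]

theorem finite_edgeCopies (e : E.Edge) : (σ.baseEdge ⁻¹' {e}).Finite := by
  refine Set.Finite.of_finite_image (f := σ.graph.s)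
    ((σ.finite_vertexCopies (E.s e)).subset ?_) ?_
  · rintro _ ⟨a, rfl, rfl⟩
    exact σ.baseVertex_s a
  · intro a ha b hb h
    exact σ.edge_ext ((show _ = e from ha).trans (show _ = e from hb).symm) h

/-- The finite set of copies of an edge. -/
def edgeCopies (e : E.Edge) : Finset σ.graph.Edge := (σ.finite_edgeCopies e).toFinset

@[simp]
theorem mem_edgeCopies {e : E.Edge} {a : σ.graph.Edge} :
    a ∈ σ.edgeCopies e ↔ σ.baseEdge a = e := by
  simp [edgeCopies]

/-- The sources of the copies of `e` are the copies of `s e`, each occurring once. -/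
theorem sum_edgeCopies {M : Type*} [AddCommMonoid M] (e : E.Edge) (g : σ.graph.Vertex → M) :
    ∑ a ∈ σ.edgeCopies e, g (σ.graph.s a) = ∑ x ∈ σ.vertexCopies (E.s e), g x := by
  refine Finset.sum_nbij σ.graph.s ?_ ?_ ?_ fun _ _ => rfl
  · intro a ha
    rw [mem_edgeCopies] at ha
    rw [mem_vertexCopies, baseVertex_s, ha]
  · intro a ha b hb h
    simp only [Finset.mem_coe, mem_edgeCopies] at ha hb
    exact σ.edge_ext (ha.trans hb.symm) h
  · intro x hx
    simp only [Finset.mem_coe, mem_vertexCopies] at hx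
    obtain ⟨a, ha, rfl⟩ := σ.exists_edge hx
    exact ⟨a, by simpa using ha, rfl⟩

variable [E.RowFinite]

/-- The edges of `E` all of whose copies end at the vertex `x` of the in-split graph; these form
the partition set that `x` stands for. -/
def baseInto (x : σ.graph.Vertex) : Finset E.Edge :=
  (E.into (σ.baseVertex x)).filter fun e => σ.rangeCopy e = x

theorem mem_baseInto {x : σ.graph.Vertex} {e : E.Edge} :
    e ∈ σ.baseInto x ↔ σ.rangeCopy e = x := by
  rw [baseInto, Finset.mem_filter, DirectedGraph.mem_into, and_iff_right_iff_imp]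
  rintro rfl
  rfl

theorem sum_into {M : Type*} [AddCommMonoid M] (x : σ.graph.Vertex) (g : σ.graph.Edge → M) :
    ∑ e ∈ σ.baseInto x, ∑ a ∈ σ.edgeCopies e, g a = ∑ a ∈ σ.graph.into x, g a := by
  have hmaps : ∀ a ∈ σ.graph.into x, σ.baseEdge a ∈ σ.baseInto x := by
    intro a ha
    rwa [mem_baseInto, ← r_eq_rangeCopy, ← DirectedGraph.mem_into]
  rw [← Finset.sum_fiberwise_of_maps_to hmaps]
  refine Finset.sum_congr rfl fun e he => Finset.sum_congr ?_ fun _ _ => rfl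
  ext a
  rw [mem_edgeCopies, Finset.mem_filter, DirectedGraph.mem_into, r_eq_rangeCopy]
  rw [mem_baseInto] at he
  constructor
  · rintro rfl
    exact ⟨he, rfl⟩
  · exact And.right

/-- The partition of `r⁻¹(x)`, as an identity of sums. -/
theorem sum_vertexCopies_baseInto {M : Type*} [AddCommMonoid M] (x : E.Vertex) (g : E.Edge → M) :
    ∑ y ∈ σ.vertexCopies x, ∑ e ∈ σ.baseInto y, g e = ∑ e ∈ E.into x, g e := by
  have hmaps : ∀ e ∈ E.into x, σ.rangeCopy e ∈ σ.vertexCopies x := by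
    intro e he
    rwa [mem_vertexCopies, baseVertex_rangeCopy, ← DirectedGraph.mem_into]
  rw [← Finset.sum_fiberwise_of_maps_to hmaps]
  refine Finset.sum_congr rfl fun y hy => ?_
  rw [baseInto, σ.mem_vertexCopies.1 hy]

end InSplit

/-! ### The two Cuntz–Krieger families of an in-split -/

namespace InSplit

variable {E : DirectedGraph.{u, v}} [E.RowFinite] (σ : InSplit E) {B : Type w}
  [NonUnitalCStarAlgebra B]

section Merge

variable (G : CKFamily σ.graph B)

/-- Distinct copies of an edge start at distinct vertices, so conjugation by the sum of their
partial isometries has no mixed terms. -/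
theorem sum_S_conj (e : E.Edge) {d : B} (hd : ∀ x, Commute (G.P x) d) :
    (∑ a ∈ σ.edgeCopies e, G.S a) * d * star (∑ a ∈ σ.edgeCopies e, G.S a) =
      ∑ a ∈ σ.edgeCopies e, G.S a * d * star (G.S a) := by
  rw [Finset.sum_mul, star_sum]
  refine sum_mul_sum_eq_sum_diag _ _ _ fun a ha b hb hab => ?_
  rw [mem_edgeCopies] at ha hb
  exact G.S_mul_mul_star_S_of_ne (fun h => hab (σ.edge_ext (ha.trans hb.symm) h)) (hd _)

theorem sum_S_mul_star_sum_S (e : E.Edge) :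
    (∑ a ∈ σ.edgeCopies e, G.S a) * star (∑ a ∈ σ.edgeCopies e, G.S a) =
      ∑ a ∈ σ.edgeCopies e, G.S a * star (G.S a) := by
  rw [star_sum]
  refine sum_mul_sum_eq_sum_diag _ _ _ fun a ha b hb hab => ?_
  rw [mem_edgeCopies] at ha hb
  exact G.S_mul_star_S_of_ne fun h => hab (σ.edge_ext (ha.trans hb.symm) h)

/-- A family for the in-split graph gives one for `E`: add up the copies. -/
def mergeFamily : CKFamily E B where
  S e := ∑ a ∈ σ.edgeCopies e, G.S a
  P x := ∑ y ∈ σ.vertexCopies x, G.P y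
  partialIsometry e := by
    rw [σ.sum_S_mul_star_sum_S G, sum_mul_sum_eq_sum_diag]
    · exact Finset.sum_congr rfl fun a _ => G.partialIsometry a
    · intro a _ b _ hab
      rw [mul_assoc, G.star_S_mul_S_of_ne hab, mul_zero]
  orthogonal_ranges e f h := by
    rw [σ.sum_S_mul_star_sum_S G, σ.sum_S_mul_star_sum_S G, Finset.sum_mul_sum]
    refine Finset.sum_eq_zero fun a ha => Finset.sum_eq_zero fun b hb => ?_
    rw [mem_edgeCopies] at ha hb
    refine G.orthogonal_ranges a b ?_
    rintro rfl
    exact h (ha.symm.trans hb)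
  projection x := by
    refine ⟨?_, ?_⟩
    · rw [IsIdempotentElem, sum_mul_sum_eq_sum_diag _ _ _ fun a _ b _ hab => G.orthogonal a b hab]
      exact Finset.sum_congr rfl fun y _ => G.P_mul_P y
    · rw [IsSelfAdjoint, star_sum]
      exact Finset.sum_congr rfl fun y _ => G.star_P y
  orthogonal x y h := by
    rw [Finset.sum_mul_sum]
    refine Finset.sum_eq_zero fun a ha => Finset.sum_eq_zero fun b hb => ?_
    rw [mem_vertexCopies] at ha hb
    refine G.orthogonal a b ?_
    rintro rfl
    exact h (ha.symm.trans hb)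
  ck1 e := by
    rw [star_sum, sum_mul_sum_eq_sum_diag _ _ _ fun a _ b _ hab => G.star_S_mul_S_of_ne hab,
      ← σ.sum_edgeCopies]
    exact Finset.sum_congr rfl fun a _ => G.ck1 a
  ck2 x hx := by
    rw [← σ.sum_vertexCopies_baseInto]
    refine Finset.sum_congr rfl fun y hy => ?_
    have hy' : ¬ σ.graph.IsSource y := by
      rwa [σ.isSource_iff, σ.mem_vertexCopies.1 hy, σ.m_eq_zero_iff]
    rw [G.ck2 y hy', ← σ.sum_into]
    exact Finset.sum_congr rfl fun e _ => (σ.sum_S_mul_star_sum_S G e).symm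

end Merge

section Split

variable (F : CKFamily E B)

/-- The projection attached to the copy of a vertex: the sum of the range projections of the edges
in the corresponding partition set, or the vertex projection itself at a source. -/
def splitP (x : σ.graph.Vertex) : B :=
  if σ.m (σ.baseVertex x) = 0 then F.P (σ.baseVertex x)
  else ∑ e ∈ σ.baseInto x, F.S e * star (F.S e)

theorem isStarProjection_splitP (x : σ.graph.Vertex) : IsStarProjection (σ.splitP F x) := by
  rw [splitP]
  split_ifs with h
  · exact F.projection _
  · refine ⟨?_, ?_⟩
    · rw [IsIdempotentElem, sum_mul_sum_eq_sum_diag _ _ _ fun a _ b _ hab =>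
        F.orthogonal_ranges a b hab]
      exact Finset.sum_congr rfl fun e _ => (F.isStarProjection_range e).isIdempotentElem
    · rw [IsSelfAdjoint, star_sum]
      exact Finset.sum_congr rfl fun e _ => (F.isStarProjection_range e).isSelfAdjoint

theorem star_splitP (x : σ.graph.Vertex) : star (σ.splitP F x) = σ.splitP F x :=
  (σ.isStarProjection_splitP F x).isSelfAdjoint

theorem splitP_mul_splitP (x : σ.graph.Vertex) :
    σ.splitP F x * σ.splitP F x = σ.splitP F x :=
  (σ.isStarProjection_splitP F x).isIdempotentElem

theorem P_mul_splitP (x : σ.graph.Vertex) :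
    F.P (σ.baseVertex x) * σ.splitP F x = σ.splitP F x := by
  rw [splitP]
  split_ifs with h
  · exact F.P_mul_P _
  · rw [Finset.mul_sum]
    refine Finset.sum_congr rfl fun e he => ?_
    rw [mem_baseInto] at he
    rw [← he, baseVertex_rangeCopy, ← mul_assoc, F.P_mul_S]

theorem splitP_orthogonal {x y : σ.graph.Vertex} (h : x ≠ y) :
    σ.splitP F x * σ.splitP F y = 0 := by
  by_cases hb : σ.baseVertex x = σ.baseVertex y
  · have hx : σ.m (σ.baseVertex x) ≠ 0 := fun h0 => h (σ.eq_of_baseVertex_eq hb h0)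
    rw [splitP, splitP, if_neg hx, if_neg (hb ▸ hx), Finset.sum_mul_sum]
    refine Finset.sum_eq_zero fun e he => Finset.sum_eq_zero fun f hf => ?_
    rw [mem_baseInto] at he hf
    refine F.orthogonal_ranges e f ?_
    rintro rfl
    exact h (he.symm.trans hf)
  · rw [← σ.star_splitP F x, ← σ.P_mul_splitP F x, ← σ.P_mul_splitP F y, star_mul, F.star_P,
      mul_assoc, ← mul_assoc (F.P _), F.orthogonal _ _ hb, zero_mul, mul_zero]

theorem sum_splitP (x : E.Vertex) : ∑ y ∈ σ.vertexCopies x, σ.splitP F y = F.P x := by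
  by_cases hx : σ.m x = 0
  · obtain ⟨y, rfl⟩ := σ.exists_baseVertex_eq hx
    rw [Finset.sum_eq_single y]
    · rw [splitP, if_pos hx]
    · intro z hz hzy
      exact absurd (σ.eq_of_baseVertex_eq (σ.mem_vertexCopies.1 hz).symm hx).symm hzy
    · intro hy
      exact absurd (σ.mem_vertexCopies.2 rfl) hy
  · rw [F.ck2 x (by rwa [← σ.m_eq_zero_iff]), ← σ.sum_vertexCopies_baseInto]
    refine Finset.sum_congr rfl fun y hy => ?_
    rw [splitP, σ.mem_vertexCopies.1 hy, if_neg hx]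

theorem P_s_mul_splitP_s (a : σ.graph.Edge) :
    F.P (E.s (σ.baseEdge a)) * σ.splitP F (σ.graph.s a) = σ.splitP F (σ.graph.s a) := by
  rw [← baseVertex_s, P_mul_splitP]

theorem star_mul_self_S_mul_splitP (a : σ.graph.Edge) :
    star (F.S (σ.baseEdge a) * σ.splitP F (σ.graph.s a)) *
      (F.S (σ.baseEdge a) * σ.splitP F (σ.graph.s a)) = σ.splitP F (σ.graph.s a) := by
  rw [star_mul, star_splitP, mul_assoc, ← mul_assoc (star _), F.ck1, P_s_mul_splitP_s,
    splitP_mul_splitP]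

/-- A family for `E` gives one for the in-split graph: cut each `S e` down to the projections of
the copies of `s e`. -/
def splitFamily : CKFamily σ.graph B where
  S a := F.S (σ.baseEdge a) * σ.splitP F (σ.graph.s a)
  P := σ.splitP F
  partialIsometry a := by
    rw [mul_assoc, star_mul_self_S_mul_splitP, mul_assoc, splitP_mul_splitP]
  orthogonal_ranges a b h := by
    have key : star (F.S (σ.baseEdge a) * σ.splitP F (σ.graph.s a)) *
        (F.S (σ.baseEdge b) * σ.splitP F (σ.graph.s b)) = 0 := by
      rw [star_mul, star_splitP, mul_assoc, ← mul_assoc (star _)]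
      by_cases hb : σ.baseEdge a = σ.baseEdge b
      · rw [hb, F.ck1, P_s_mul_splitP_s]
        exact σ.splitP_orthogonal F fun hs => h (σ.edge_ext hb hs)
      · rw [F.star_S_mul_S_of_ne hb, zero_mul, mul_zero]
    rw [mul_assoc, ← mul_assoc (star _), key, zero_mul, mul_zero]
  projection := σ.isStarProjection_splitP F
  orthogonal _ _ h := σ.splitP_orthogonal F h
  ck1 := σ.star_mul_self_S_mul_splitP F
  ck2 x hx := by
    rw [σ.isSource_iff] at hx
    rw [splitP, if_neg hx, ← σ.sum_into]
    refine Finset.sum_congr rfl fun e _ => ?_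
    have h1 : ∀ a ∈ σ.edgeCopies e,
        F.S (σ.baseEdge a) * σ.splitP F (σ.graph.s a) *
          star (F.S (σ.baseEdge a) * σ.splitP F (σ.graph.s a)) =
        F.S e * σ.splitP F (σ.graph.s a) * star (F.S e) := by
      intro a ha
      rw [σ.mem_edgeCopies.1 ha, star_mul, star_splitP, ← mul_assoc, mul_assoc (F.S e),
        splitP_mul_splitP]
    rw [Finset.sum_congr rfl h1, ← Finset.sum_mul, ← Finset.mul_sum, σ.sum_edgeCopies,
      sum_splitP, F.S_mul_P]

theorem sum_splitFamily_S (e : E.Edge) :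
    ∑ a ∈ σ.edgeCopies e, (σ.splitFamily F).S a = F.S e := by
  have h1 : ∀ a ∈ σ.edgeCopies e, (σ.splitFamily F).S a =
      F.S e * σ.splitP F (σ.graph.s a) := fun a ha => by
    change F.S (σ.baseEdge a) * _ = _
    rw [σ.mem_edgeCopies.1 ha]
  rw [Finset.sum_congr rfl h1, ← Finset.mul_sum, σ.sum_edgeCopies, sum_splitP, F.S_mul_P]

end Split

theorem splitP_mergeFamily (G : CKFamily σ.graph B) (x : σ.graph.Vertex) :
    σ.splitP (σ.mergeFamily G) x = G.P x := by
  by_cases hx : σ.m (σ.baseVertex x) = 0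
  · rw [splitP, if_pos hx]
    refine Finset.sum_eq_single x (fun z hz hzx => ?_) fun hn =>
      absurd (σ.mem_vertexCopies.2 rfl) hn
    exact absurd (σ.eq_of_baseVertex_eq (σ.mem_vertexCopies.1 hz).symm hx).symm hzx
  · rw [splitP, if_neg hx, G.ck2 x (by rwa [σ.isSource_iff]), ← σ.sum_into]
    exact Finset.sum_congr rfl fun e _ => σ.sum_S_mul_star_sum_S G e

theorem splitFamily_mergeFamily_S (G : CKFamily σ.graph B) (a : σ.graph.Edge) :
    (σ.splitFamily (σ.mergeFamily G)).S a = G.S a := by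
  change (∑ b ∈ σ.edgeCopies (σ.baseEdge a), G.S b) * σ.splitP (σ.mergeFamily G) _ = _
  rw [splitP_mergeFamily, Finset.sum_mul, Finset.sum_eq_single a, G.S_mul_P]
  · intro b hb hba
    exact G.S_mul_P_of_ne fun h => hba (σ.edge_ext (σ.mem_edgeCopies.1 hb) h)
  · exact fun hn => absurd (σ.mem_edgeCopies.2 rfl) hn

/-! ### The isomorphism -/

/-- The ⋆-homomorphism `C⋆(E) → C⋆(E₂)` that sends a generator to the sum of its copies. -/
def toSplit : GraphAlgebra E →⋆ₙₐ[ℂ] GraphAlgebra σ.graph :=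
  lift (σ.mergeFamily (universalFamily σ.graph))

/-- The ⋆-homomorphism `C⋆(E₂) → C⋆(E)` given by cutting down the generators. -/
def ofSplit : GraphAlgebra σ.graph →⋆ₙₐ[ℂ] GraphAlgebra E :=
  lift (σ.splitFamily (universalFamily E))

theorem toSplit_S (e : E.Edge) : σ.toSplit ((universalFamily E).S e) =
    ∑ a ∈ σ.edgeCopies e, (universalFamily σ.graph).S a :=
  lift_S _ _

theorem toSplit_P (x : E.Vertex) : σ.toSplit ((universalFamily E).P x) =
    ∑ y ∈ σ.vertexCopies x, (universalFamily σ.graph).P y :=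
  lift_P _ _

theorem ofSplit_S (a : σ.graph.Edge) : σ.ofSplit ((universalFamily σ.graph).S a) =
    (universalFamily E).S (σ.baseEdge a) * σ.splitP (universalFamily E) (σ.graph.s a) :=
  lift_S _ _

theorem ofSplit_P (x : σ.graph.Vertex) : σ.ofSplit ((universalFamily σ.graph).P x) =
    σ.splitP (universalFamily E) x :=
  lift_P _ _

theorem toSplit_splitP (x : σ.graph.Vertex) :
    σ.toSplit (σ.splitP (universalFamily E) x) = (universalFamily σ.graph).P x := by
  rw [← σ.splitP_mergeFamily (universalFamily σ.graph), splitP, splitP]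
  split_ifs
  · exact lift_P _ _
  · simp only [map_sum, map_mul, map_star]
    exact Finset.sum_congr rfl fun e _ => by rw [toSplit_S]; rfl

theorem ofSplit_comp_toSplit :
    σ.ofSplit.comp σ.toSplit = NonUnitalStarAlgHom.id ℂ (GraphAlgebra E) := by
  refine hom_ext (fun e => ?_) fun x => ?_
  · rw [NonUnitalStarAlgHom.comp_apply, toSplit_S, map_sum]
    simp only [ofSplit_S]
    exact σ.sum_splitFamily_S _ e
  · rw [NonUnitalStarAlgHom.comp_apply, toSplit_P, map_sum]
    simp only [ofSplit_P]
    exact σ.sum_splitP _ x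

theorem toSplit_comp_ofSplit :
    σ.toSplit.comp σ.ofSplit = NonUnitalStarAlgHom.id ℂ (GraphAlgebra σ.graph) := by
  refine hom_ext (fun a => ?_) fun x => ?_
  · rw [NonUnitalStarAlgHom.comp_apply, ofSplit_S, map_mul, toSplit_splitP, toSplit_S,
      ← σ.splitP_mergeFamily (universalFamily σ.graph)]
    exact σ.splitFamily_mergeFamily_S _ a
  · rw [NonUnitalStarAlgHom.comp_apply, ofSplit_P, toSplit_splitP]
    rfl

theorem toSplit_ofSplit (b : GraphAlgebra σ.graph) : σ.toSplit (σ.ofSplit b) = b :=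
  DFunLike.congr_fun σ.toSplit_comp_ofSplit b

theorem ofSplit_toSplit (a : GraphAlgebra E) : σ.ofSplit (σ.toSplit a) = a :=
  DFunLike.congr_fun σ.ofSplit_comp_toSplit a

theorem toSplit_mem_diagonal {a : GraphAlgebra E} (ha : a ∈ diagonal E) :
    σ.toSplit a ∈ diagonal σ.graph := by
  refine map_mem_of_mem_diagonal _ isClosed_diagonal (fun x => ?_) (fun e d hd => ?_) ha
  · rw [toSplit_P]
    exact sum_mem fun y _ => P_mem_diagonal y
  · rw [toSplit_S, σ.sum_S_conj _ e fun x => commute_P_of_mem_diagonal x hd]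
    exact sum_mem fun a _ => conj_S_mem_diagonal a hd

theorem splitP_mem_diagonal (x : σ.graph.Vertex) :
    σ.splitP (universalFamily E) x ∈ diagonal E := by
  rw [splitP]
  split_ifs
  · exact P_mem_diagonal _
  · exact sum_mem fun e _ => S_mul_star_S_mem_diagonal e

theorem ofSplit_mem_diagonal {b : GraphAlgebra σ.graph} (hb : b ∈ diagonal σ.graph) :
    σ.ofSplit b ∈ diagonal E := by
  refine map_mem_of_mem_diagonal _ isClosed_diagonal (fun x => ?_) (fun a d hd => ?_) hb
  · rw [ofSplit_P]
    exact σ.splitP_mem_diagonal x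
  · have hq := σ.splitP_mem_diagonal (σ.graph.s a)
    have h := conj_S_mem_diagonal (σ.baseEdge a) (mul_mem (mul_mem hq hd) hq)
    rw [ofSplit_S, star_mul, star_splitP]
    simpa only [mul_assoc] using h

/-- The isomorphism `C⋆(E) ≃ C⋆(E₂)` of an in-split. -/
def splitEquiv : GraphAlgebra E ≃⋆ₐ[ℂ] GraphAlgebra σ.graph :=
  StarAlgEquiv.ofBijective σ.toSplit
    ⟨Function.LeftInverse.injective σ.ofSplit_toSplit,
      Function.RightInverse.surjective σ.toSplit_ofSplit⟩

theorem toSplit_comp_gauge (f : E.Edge → ℤ) (z : Circle) :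
    σ.toSplit.comp (gauge E f z) = (gauge σ.graph (f ∘ σ.baseEdge) z).comp σ.toSplit := by
  refine hom_ext (fun e => ?_) fun x => ?_
  · simp only [NonUnitalStarAlgHom.comp_apply, gauge_S, map_smul, toSplit_S, map_sum,
      Finset.smul_sum]
    refine Finset.sum_congr rfl fun a ha => ?_
    rw [Function.comp_apply, σ.mem_edgeCopies.1 ha]
  · simp only [NonUnitalStarAlgHom.comp_apply, gauge_P, toSplit_P, map_sum]

end InSplit

end GraphCStar

end

theorem mainTheorem2 (E₁ : GraphCStar.DirectedGraph.{u, v}) [E₁.RowFinite]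
    (σ : GraphCStar.InSplit E₁) (hσ : σ.IsProper) :
    ∃ π : GraphCStar.GraphAlgebra E₁ ≃⋆ₐ[ℂ] GraphCStar.GraphAlgebra σ.graph,
      π '' (GraphCStar.diagonal E₁ : Set (GraphCStar.GraphAlgebra E₁)) =
          (GraphCStar.diagonal σ.graph : Set (GraphCStar.GraphAlgebra σ.graph)) ∧
        ∀ f : E₁.Edge → ℤ, ∃ g : σ.graph.Edge → ℤ, ∀ z : Circle,
          π ∘ GraphCStar.gauge E₁ f z = GraphCStar.gauge σ.graph g z ∘ π := by
  refine ⟨σ.splitEquiv, Set.Subset.antisymm ?_ ?_, fun f => ⟨f ∘ σ.baseEdge, fun z => ?_⟩⟩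
  · rintro _ ⟨a, ha, rfl⟩
    exact σ.toSplit_mem_diagonal ha
  · exact fun b hb => ⟨σ.ofSplit b, σ.ofSplit_mem_diagonal hb, σ.toSplit_ofSplit b⟩
  · exact congrArg DFunLike.coe (σ.toSplit_comp_gauge f z)
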